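/- Let $Q=\{(x,y)\in\mathbb R^2: |x|<1,\ |y|<1\}$ be the open square with the Riemannian metric $ds^2=(1-y^2)\,dx^2+(1-x^2)\,dy^2$. Then $(Q,ds^2)$ has an embedded closed geodesic, i.e. there are a smooth curve $\gamma=(x,y):\mathbb R\to Q$ that satisfies the geodesic equation of the Levi-Civita connection of $ds^2$, and a number $T>0$, such that $\gamma$ is periodic with period $8T$, injective on $[0,8T)$, and $\dot\gamma$ never vanishes. Moreover, $\gamma$ and $T$ can be chosen such that 1. $\gamma$ leaves the positive $y$-axis horizontally at time $0$: $x(0)=0$, $y(0)>0$, $\dot x(0)>0$, $\dot y(0)=0$; 2. $0<x(t)<y(t)$ for $0<t<T$, and at time $T$ the curve meets the diagonal orthogonally: $x(T)=y(T)>0$, and $\dot\gamma(T)$ is orthogonal to $(1,1)$ with respect to $ds^2$; 3. $\gamma$ is the extension of the arc $\gamma|_{[0,T]}$ by reflection in the $y$-axis and in the diagonal: $(x,y)(-t)=(-x(t),y(t))$ and $(x,y)(2T-t)=(y(t),x(t))$ for all $t\in\mathbb R$. -/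

import Mathlib

open scoped ContDiff

noncomputable section

/-- A smooth Riemannian metric `g_{ij}` on a subset `U` of `ℝⁿ` (open, in the use below),
given by its matrix in the standard coordinates. -/
structure CoordMetric (n : ℕ) (U : Set (Fin n → ℝ)) where
  /-- the matrix `(g_{ij}(p))` -/
  mat : (Fin n → ℝ) → Matrix (Fin n) (Fin n) ℝ
  /-- the coefficients are smooth on `U` -/
  smooth : ∀ i j, ContDiffOn ℝ ∞ (fun p => mat p i j) U
  /-- the matrix is symmetric and positive definite at each point of `U` -/
  posDef : ∀ p ∈ U, (mat p).PosDef

namespace CoordMetric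

variable {n : ℕ} {U : Set (Fin n → ℝ)}

/-- The inner product `g_p(v, w)` of two tangent vectors at `p`. -/
def inner (g : CoordMetric n U) (p v w : Fin n → ℝ) : ℝ :=
  ∑ i, ∑ j, g.mat p i j * v i * w j

/-- The partial derivative `∂ₖ g_{ij}` at `p`. -/
def partialDeriv (g : CoordMetric n U) (k i j : Fin n) (p : Fin n → ℝ) : ℝ :=
  fderiv ℝ (fun q => g.mat q i j) p (Pi.single k 1)

/-- The Christoffel symbol of the Levi-Civita connection,
`Γᵏᵢⱼ = ½ ∑ₗ gᵏˡ (∂ᵢ g_{jl} + ∂ⱼ g_{il} - ∂ₗ g_{ij})`. -/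
def christoffel (g : CoordMetric n U) (k i j : Fin n) (p : Fin n → ℝ) : ℝ :=
  (1 / 2) * ∑ l, (g.mat p)⁻¹ k l *
    (g.partialDeriv i j l p + g.partialDeriv j i l p - g.partialDeriv l i j p)

/-- A smooth curve `γ : ℝ → U` which satisfies the geodesic equation
`γ̈ᵏ + ∑ᵢⱼ Γᵏᵢⱼ γ̇ⁱ γ̇ʲ = 0`. -/
structure IsGeodesic (g : CoordMetric n U) (γ : ℝ → Fin n → ℝ) : Prop where
  mem : ∀ t, γ t ∈ U
  smooth : ContDiff ℝ ∞ γ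
  eqn : ∀ t k, deriv (deriv γ) t k +
    ∑ i, ∑ j, g.christoffel k i j (γ t) * deriv γ t i * deriv γ t j = 0

/-- An embedded closed geodesic of period `L`: a periodic geodesic which is an immersion and
which is injective on one period. So it induces an injective immersion, hence an embedding,
of the circle `ℝ / L ℤ` into `U`. -/
structure IsEmbeddedClosedGeodesic (g : CoordMetric n U) (γ : ℝ → Fin n → ℝ) (L : ℝ) :
    Prop where
  geodesic : g.IsGeodesic γ
  period_pos : 0 < L
  periodic : Function.Periodic γ L
  immersion : ∀ t, deriv γ t ≠ 0
  injOn : Set.InjOn γ (Set.Ico 0 L)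

end CoordMetric

/-- The open square `|x| < 1`, `|y| < 1`, with `x = p 0` and `y = p 1`. -/
def openSquare : Set (Fin 2 → ℝ) := {p | |p 0| < 1 ∧ |p 1| < 1}

/-- The metric `(1 - y²) dx² + (1 - x²) dy²` on the open square. -/
def squareMetric : CoordMetric 2 openSquare where
  mat p := Matrix.diagonal ![1 - p 1 ^ 2, 1 - p 0 ^ 2]
  smooth i j := by
    apply ContDiff.contDiffOn
    fin_cases i <;> fin_cases j <;> simp <;> fun_prop
  posDef p hp := by
    obtain ⟨hx, hy⟩ := hp
    refine Matrix.PosDef.diagonal fun i => ?_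
    fin_cases i
    · simpa using hy
    · simpa using hx

end

/-! With the momenta p = (1 - y²)ẋ and q = (1 - x²)ẏ the geodesic flow is Hamiltonian, and p + q is
the inner product of the velocity with (1, 1). Shoot from (0, a) with (p, q) = (1, 0). In
`arcRegion` energy conservation forces p ≥ 7/10, so x grows at a definite rate while y ≤ a, and the
arc must exit, by reaching the diagonal or by p + q = 0 (`IsPhaseCurve.exists_exit`). For a = 1/4
only the first exit is possible (`IsArc.turn_pos_of_low`), for a = 15/16 only the second
(`IsArc.gap_pos_of_high`). The heights with each kind of exit form closed sets
(`isClosed_setOf_exists_isArc`) which cover a connected interval, so some height has both exits;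
strict monotonicity of y - x and p + q makes the two exit times equal.

Uniqueness of solutions then yields the two reflection symmetries. Their composition is a quarter
turn, and the piece over [-T, T) is a graph over the x-axis in the cone -y ≤ x < y, so its four
rotated copies form a simple closed curve. Cutting off the vector field makes the flow global; the
arcs used never see the cut-off. -/

open Set Function Topology
open scoped NNReal

/-! ### Global flows of autonomous Lipschitz equations -/

section AutonomousODE

variable {E : Type*} [NormedAddCommGroup E] [NormedSpace ℝ E]

/-- Two global solutions of a Lipschitz autonomous equation which agree at one time are equal. -/
theorem eq_of_hasDerivAt_of_lipschitz {f : E → E} {K : ℝ≥0} (hK : LipschitzWith K f)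
    {z w : ℝ → E} (hz : ∀ t, HasDerivAt z (f (z t)) t) (hw : ∀ t, HasDerivAt w (f (w t)) t)
    (t₀ : ℝ) (h : z t₀ = w t₀) : z = w :=
  ODE_solution_unique_univ (v := fun _ => f) (s := fun _ => univ) (K := K)
    (fun _ => hK.lipschitzOnWith) (fun t => ⟨hz t, mem_univ _⟩) (fun t => ⟨hw t, mem_univ _⟩) h

/-- A bounded Lipschitz vector field has global integral curves. -/
theorem exists_forall_hasDerivAt_of_lipschitz_of_bounded [CompleteSpace E] {f : E → E}
    {K L : ℝ≥0} (hK : LipschitzWith K f) (hL : ∀ x, ‖f x‖ ≤ L) (x : E) :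
    ∃ z : ℝ → E, z 0 = x ∧ ∀ t, HasDerivAt z (f (z t)) t := by
  have local_sol : ∀ b : ℝ, 0 < b → ∃ α : ℝ → E, α 0 = x ∧
      ∀ t ∈ Ioo (-b) b, HasDerivAt α (f (α t)) t := by
    intro b hb
    have h0 : (0 : ℝ) ∈ Icc (-b) b := ⟨by linarith, hb.le⟩
    -- Speed at most L keeps the solution within L * b of x, so the length of the time interval is
    -- arbitrary.
    have pl : IsPicardLindelof (fun _ => f) (⟨0, h0⟩ : Icc (-b) b) x (L * b.toNNReal) 0 L K :=
      IsPicardLindelof.of_time_independent (fun y _ => hL y) hK.lipschitzOnWith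
        (by simp [hb.le])
    obtain ⟨α, h1, h2⟩ := pl.exists_eq_forall_mem_Icc_hasDerivWithinAt₀
    exact ⟨α, h1, fun t ht => (h2 t (Ioo_subset_Icc_self ht)).hasDerivAt (Icc_mem_nhds ht.1 ht.2)⟩
  have pos : ∀ t : ℝ, 0 < |t| + 1 := fun t => by positivity
  choose α h0 hα using fun t : ℝ => local_sol (|t| + 1) (pos t)
  -- At time t the solution on an interval containing t is used; by uniqueness the choices agree
  -- near t.
  refine ⟨fun t => α t t, h0 0, fun t => ?_⟩
  have key : (fun s => α s s) =ᶠ[𝓝 t] α t := by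
    have hmem : Ioo (-(|t| + 1)) (|t| + 1) ∈ 𝓝 t :=
      Ioo_mem_nhds (by linarith [neg_abs_le t]) (by linarith [le_abs_self t])
    filter_upwards [hmem] with s hs
    have hs' : s ∈ Ioo (-(|s| + 1)) (|s| + 1) :=
      ⟨by linarith [neg_abs_le s], by linarith [le_abs_self s]⟩
    set m := min (|s| + 1) (|t| + 1) with hm
    have hmpos : 0 < m := lt_min (pos s) (pos t)
    have hsm : s ∈ Ioo (-m) m := by
      constructor
      · rw [neg_lt]; exact lt_min (by linarith [hs'.1]) (by linarith [hs.1])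
      · exact lt_min hs'.2 hs.2
    refine ODE_solution_unique_of_mem_Ioo (v := fun _ => f) (s := fun _ => univ) (K := K)
      (fun _ _ => hK.lipschitzOnWith) (t₀ := 0) ⟨by linarith, hmpos⟩
      (fun r hr => ⟨hα s r ?_, mem_univ _⟩) (fun r hr => ⟨hα t r ?_, mem_univ _⟩)
      (by rw [h0, h0]) hsm
    · exact ⟨by linarith [hr.1, min_le_left (|s| + 1) (|t| + 1)],
        hr.2.trans_le (min_le_left _ _)⟩
    · exact ⟨by linarith [hr.1, min_le_right (|s| + 1) (|t| + 1)],
        hr.2.trans_le (min_le_right _ _)⟩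
  exact (hα t t ⟨by linarith [neg_abs_le t], by linarith [le_abs_self t]⟩).congr_of_eventuallyEq key

/-- Integral curves of a smooth vector field are smooth. -/
theorem contDiff_of_hasDerivAt_of_contDiff {f : E → E} (hf : ContDiff ℝ ∞ f) {z : ℝ → E}
    (hz : ∀ t, HasDerivAt z (f (z t)) t) : ContDiff ℝ ∞ z := by
  have hd : deriv z = fun t => f (z t) := funext fun t => (hz t).deriv
  rw [contDiff_infty]
  intro n
  induction n with
  | zero =>
    simpa using continuous_iff_continuousAt.2 fun t => (hz t).continuousAt
  | succ n ih =>
    push_cast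
    rw [contDiff_succ_iff_deriv]
    refine ⟨fun t => (hz t).differentiableAt, by simp, ?_⟩
    rw [hd]
    exact (contDiff_infty.1 hf n).comp ih

/-- The solutions of a Lipschitz autonomous equation depend continuously on time and on
the initial value, on a compact interval of times. -/
theorem continuousOn_uncurry_of_hasDerivAt_of_lipschitz {X : Type*} [PseudoMetricSpace X]
    {f : E → E} {K C : ℝ≥0} (hK : LipschitzWith K f) {z : X → ℝ → E}
    (hz : ∀ a t, HasDerivAt (z a) (f (z a t)) t) (h0 : LipschitzWith C fun a => z a 0) (b : ℝ) :
    ContinuousOn (uncurry z) (univ ×ˢ Icc 0 b) := by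
  refine continuousOn_prod_of_continuousOn_lipschitzOnWith _ (C * (Real.exp (K * b)).toNNReal)
    (fun a _ t _ => (hz a t).continuousAt.continuousWithinAt) fun t ht => ?_
  refine LipschitzOnWith.of_dist_le_mul fun a _ c _ => ?_
  have h := dist_le_of_trajectories_ODE (v := fun _ => f) (K := K) (f := z a) (g := z c)
    (a := 0) (b := b) (fun _ => hK)
    (fun t _ => (hz a t).continuousAt.continuousWithinAt) (fun t _ => (hz a t).hasDerivWithinAt)
    (fun t _ => (hz c t).continuousAt.continuousWithinAt) (fun t _ => (hz c t).hasDerivWithinAt)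
    (h0.dist_le_mul a c) t ht
  refine h.trans ?_
  have : Real.exp (K * (t - 0)) ≤ Real.exp (K * b) := by
    gcongr; linarith [ht.2]
  simp only [NNReal.coe_mul, Real.coe_toNNReal _ (Real.exp_pos _).le]
  calc C * dist a c * Real.exp (K * (t - 0)) ≤ C * dist a c * Real.exp (K * b) := by gcongr
    _ = _ := by ring

end AutonomousODE

/-! ### The cut-off geodesic vector field -/

/-- A smooth even positive function which is `1 / (1 - s²)` for `|s| ≤ 15 / 16`. -/
noncomputable def warp (s : ℝ) : ℝ := (1 - s ^ 2 * Real.smoothTransition (20 * (1 - s ^ 2) - 1))⁻¹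

/-- The transition factor vanishes once s² ≥ 19/20, so s² < 1 wherever it matters. -/
theorem warp_denom_pos (s : ℝ) :
    0 < 1 - s ^ 2 * Real.smoothTransition (20 * (1 - s ^ 2) - 1) := by
  rcases le_total (20 * (1 - s ^ 2) - 1) 0 with h | h
  · rw [Real.smoothTransition.zero_of_nonpos h]; norm_num
  · have := mul_le_mul_of_nonneg_left (Real.smoothTransition.le_one (20 * (1 - s ^ 2) - 1))
      (sq_nonneg s)
    linarith

theorem warp_pos (s : ℝ) : 0 < warp s := inv_pos.2 (warp_denom_pos s)

theorem warp_neg (s : ℝ) : warp (-s) = warp s := by simp [warp]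

theorem warp_eq {s : ℝ} (hs : s ^ 2 ≤ 225 / 256) : warp s = (1 - s ^ 2)⁻¹ := by
  rw [warp, Real.smoothTransition.one_of_one_le (by linarith), mul_one]

theorem contDiff_warp : ContDiff ℝ ∞ warp := by
  refine ContDiff.inv ?_ fun s => (warp_denom_pos s).ne'
  have h : ContDiff ℝ ∞ Real.smoothTransition := Real.smoothTransition.contDiff
  fun_prop

/-- A smooth cut-off function on phase space. -/
noncomputable def phaseCutoff (z : ℝ × ℝ × ℝ × ℝ) : ℝ :=
  Real.smoothTransition (5 - (z.1 ^ 2 + z.2.1 ^ 2 + z.2.2.1 ^ 2 + z.2.2.2 ^ 2))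

/-- The geodesic vector field of `squareMetric` in the coordinates `(x, y, p, q)` of phase space,
`p = (1 - y²) ẋ` and `q = (1 - x²) ẏ`, cut off near the boundary and near infinity. -/
noncomputable def phaseField (z : ℝ × ℝ × ℝ × ℝ) : ℝ × ℝ × ℝ × ℝ :=
  phaseCutoff z • (z.2.2.1 * warp z.2.1, z.2.2.2 * warp z.1,
    -(z.1 * z.2.2.2 ^ 2 * warp z.1 ^ 2), -(z.2.1 * z.2.2.1 ^ 2 * warp z.2.1 ^ 2))

theorem contDiff_phaseField : ContDiff ℝ ∞ phaseField := by
  have h : ContDiff ℝ ∞ Real.smoothTransition := Real.smoothTransition.contDiff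
  have h' := contDiff_warp
  unfold phaseField phaseCutoff
  fun_prop

theorem hasCompactSupport_phaseField : HasCompactSupport phaseField := by
  refine HasCompactSupport.intro (isCompact_closedBall (0 : ℝ × ℝ × ℝ × ℝ) 3) fun z hz => ?_
  have : phaseCutoff z = 0 := by
    refine Real.smoothTransition.zero_of_nonpos ?_
    by_contra! hlt
    apply hz
    rw [mem_closedBall_zero_iff]
    simp only [norm_prod_le_iff, Real.norm_eq_abs]
    refine ⟨?_, ?_, ?_, ?_⟩ <;> refine abs_le_of_sq_le_sq ?_ (by norm_num) <;> nlinarith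
  simp [phaseField, this]

theorem exists_lipschitzWith_phaseField : ∃ K : ℝ≥0, LipschitzWith K phaseField :=
  ContDiff.lipschitzWith_of_hasCompactSupport hasCompactSupport_phaseField
    contDiff_phaseField (by simp)

theorem exists_phaseField_solution (z₀ : ℝ × ℝ × ℝ × ℝ) :
    ∃ z : ℝ → ℝ × ℝ × ℝ × ℝ, z 0 = z₀ ∧ ∀ t, HasDerivAt z (phaseField (z t)) t := by
  obtain ⟨K, hK⟩ := exists_lipschitzWith_phaseField
  obtain ⟨C, hC⟩ := hasCompactSupport_phaseField.exists_bound_of_continuous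
    contDiff_phaseField.continuous
  exact exists_forall_hasDerivAt_of_lipschitz_of_bounded (L := C.toNNReal) hK
    (fun x => (hC x).trans (Real.le_coe_toNNReal C)) z₀

theorem le_of_hasDerivAt_nonpos {f f' : ℝ → ℝ} {a b : ℝ} (hab : a ≤ b)
    (hf : ∀ t, HasDerivAt f (f' t) t) (h : ∀ t ∈ Icc a b, f' t ≤ 0) : f b ≤ f a := by
  refine antitoneOn_of_deriv_nonpos (convex_Icc a b)
    (fun t _ => (hf t).continuousAt.continuousWithinAt)
    (fun t _ => (hf t).differentiableAt.differentiableWithinAt) (fun t ht => ?_)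
    (left_mem_Icc.2 hab) (right_mem_Icc.2 hab) hab
  rw [(hf t).deriv]
  exact h t (interior_subset ht)

theorem lt_of_hasDerivAt_neg {f f' : ℝ → ℝ} {a b : ℝ} (hab : a < b)
    (hf : ∀ t, HasDerivAt f (f' t) t) (h : ∀ t ∈ Ioo a b, f' t < 0) : f b < f a := by
  refine strictAntiOn_of_deriv_neg (convex_Icc a b)
    (fun t _ => (hf t).continuousAt.continuousWithinAt) (fun t ht => ?_)
    (left_mem_Icc.2 hab.le) (right_mem_Icc.2 hab.le) hab
  rw [(hf t).deriv]
  exact h t (by simpa using ht)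

/-- The part of phase space in which `phaseField` is the geodesic vector field. -/
def PhaseBox (z : ℝ × ℝ × ℝ × ℝ) : Prop :=
  z.1 ^ 2 ≤ 225 / 256 ∧ z.2.1 ^ 2 ≤ 225 / 256 ∧ z.2.2.1 ^ 2 ≤ 1 ∧ z.2.2.2 ^ 2 ≤ 1

theorem phaseCutoff_nonneg (z : ℝ × ℝ × ℝ × ℝ) : 0 ≤ phaseCutoff z :=
  Real.smoothTransition.nonneg _

theorem PhaseBox.phaseField_eq {z : ℝ × ℝ × ℝ × ℝ} (h : PhaseBox z) :
    phaseField z = (z.2.2.1 * (1 - z.2.1 ^ 2)⁻¹, z.2.2.2 * (1 - z.1 ^ 2)⁻¹,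
      -(z.1 * z.2.2.2 ^ 2 * (1 - z.1 ^ 2)⁻¹ ^ 2),
      -(z.2.1 * z.2.2.1 ^ 2 * (1 - z.2.1 ^ 2)⁻¹ ^ 2)) := by
  obtain ⟨hx, hy, hp, hq⟩ := h
  -- In the box the sum of squares is at most 225/128 + 2 < 4.
  have : phaseCutoff z = 1 := Real.smoothTransition.one_of_one_le (by linarith)
  rw [phaseField, this, one_smul, warp_eq hx, warp_eq hy]

/-- The integral curves of `phaseField`. -/
def IsPhaseCurve (z : ℝ → ℝ × ℝ × ℝ × ℝ) : Prop :=
  ∀ t, HasDerivAt z (phaseField (z t)) t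

namespace IsPhaseCurve

variable {z : ℝ → ℝ × ℝ × ℝ × ℝ}

theorem hasDerivAt_x (hz : IsPhaseCurve z) (t : ℝ) :
    HasDerivAt (fun t => (z t).1) (phaseField (z t)).1 t := (hz t).fst

theorem hasDerivAt_y (hz : IsPhaseCurve z) (t : ℝ) :
    HasDerivAt (fun t => (z t).2.1) (phaseField (z t)).2.1 t := (hz t).snd.fst

theorem hasDerivAt_p (hz : IsPhaseCurve z) (t : ℝ) :
    HasDerivAt (fun t => (z t).2.2.1) (phaseField (z t)).2.2.1 t := (hz t).snd.snd.fst

theorem hasDerivAt_q (hz : IsPhaseCurve z) (t : ℝ) :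
    HasDerivAt (fun t => (z t).2.2.2) (phaseField (z t)).2.2.2 t := (hz t).snd.snd.snd

theorem continuous (hz : IsPhaseCurve z) : Continuous z :=
  continuous_iff_continuousAt.2 fun t => (hz t).continuousAt

end IsPhaseCurve

/-! ### A priori estimates for arcs -/

/-- The phase space region of the arcs which lie between the `y`-axis and the diagonal, and
have not yet turned past the direction orthogonal to the diagonal. -/
def arcRegion : Set (ℝ × ℝ × ℝ × ℝ) :=
  {z | 0 ≤ z.1 ∧ z.1 ≤ z.2.1 ∧ z.2.2.2 ≤ 0 ∧ 0 ≤ z.2.2.1 + z.2.2.2}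

theorem isClosed_arcRegion : IsClosed arcRegion := by
  simp only [arcRegion, ofPred_and]
  refine IsClosed.inter ?_ (IsClosed.inter ?_ (IsClosed.inter ?_ ?_))
  all_goals exact isClosed_le (by fun_prop) (by fun_prop)

/-- A phase curve which starts horizontally from the `y`-axis and stays in `arcRegion`
up to the time `τ`. -/
structure IsArc (z : ℝ → ℝ × ℝ × ℝ × ℝ) (a τ : ℝ) : Prop where
  curve : IsPhaseCurve z
  init : z 0 = (0, a, 1, 0)
  pos : 0 < a
  le : a ≤ 15 / 16
  mem : ∀ t ∈ Icc 0 τ, z t ∈ arcRegion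

namespace IsArc

variable {z : ℝ → ℝ × ℝ × ℝ × ℝ} {a τ t : ℝ}

/-- The cut-off factors are nonnegative, so p is monotone even before the arc is known to lie in the
box. This and `y_le` are what put it there. -/
theorem p_le_one (h : IsArc z a τ) (ht : t ∈ Icc 0 τ) : (z t).2.2.1 ≤ 1 := by
  have := le_of_hasDerivAt_nonpos ht.1 h.curve.hasDerivAt_p fun s hs => by
    obtain ⟨h1, h2, h3, h4⟩ := h.mem s ⟨hs.1, hs.2.trans ht.2⟩
    have := phaseCutoff_nonneg (z s)
    simp only [phaseField, Prod.smul_fst, Prod.smul_snd, smul_eq_mul, mul_neg, neg_nonpos]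
    positivity
  simpa [h.init] using this

theorem y_le (h : IsArc z a τ) (ht : t ∈ Icc 0 τ) : (z t).2.1 ≤ a := by
  have := le_of_hasDerivAt_nonpos ht.1 h.curve.hasDerivAt_y fun s hs => by
    obtain ⟨h1, h2, h3, h4⟩ := h.mem s ⟨hs.1, hs.2.trans ht.2⟩
    simp only [phaseField, Prod.smul_fst, Prod.smul_snd, smul_eq_mul]
    exact mul_nonpos_of_nonneg_of_nonpos (phaseCutoff_nonneg _)
      (mul_nonpos_of_nonpos_of_nonneg h3 (warp_pos _).le)
  simpa [h.init] using this

theorem phaseBox (h : IsArc z a τ) (ht : t ∈ Icc 0 τ) : PhaseBox (z t) := by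
  obtain ⟨h1, h2, h3, h4⟩ := h.mem t ht
  have hp := h.p_le_one ht
  have hy := h.y_le ht
  have ha := h.le
  refine ⟨?_, ?_, ?_, ?_⟩ <;> nlinarith

theorem y_sq_lt (h : IsArc z a τ) (ht : t ∈ Icc 0 τ) : 0 < 1 - (z t).2.1 ^ 2 := by
  linarith [(h.phaseBox ht).2.1]

theorem x_sq_lt (h : IsArc z a τ) (ht : t ∈ Icc 0 τ) : 0 < 1 - (z t).1 ^ 2 := by
  linarith [(h.phaseBox ht).1]

theorem a_sq_lt (h : IsArc z a τ) : 0 < 1 - a ^ 2 := by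
  nlinarith [h.pos, h.le]

/-- Conservation of twice the Hamiltonian, that is, of the squared speed. -/
theorem energy (h : IsArc z a τ) (ht : t ∈ Icc 0 τ) :
    (z t).2.2.1 ^ 2 / (1 - (z t).2.1 ^ 2) + (z t).2.2.2 ^ 2 / (1 - (z t).1 ^ 2)
      = 1 / (1 - a ^ 2) := by
  set f : ℝ → ℝ := fun t => (z t).2.2.1 ^ 2 / (1 - (z t).2.1 ^ 2)
    + (z t).2.2.2 ^ 2 / (1 - (z t).1 ^ 2) with hf
  have hd : ∀ s ∈ Icc 0 τ, HasDerivAt f 0 s := by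
    intro s hs
    have hx := h.curve.hasDerivAt_x s
    have hy := h.curve.hasDerivAt_y s
    have hp := h.curve.hasDerivAt_p s
    have hq := h.curve.hasDerivAt_q s
    rw [(h.phaseBox hs).phaseField_eq] at hx hy hp hq
    have e1 := (h.y_sq_lt hs).ne'
    have e2 := (h.x_sq_lt hs).ne'
    have := ((hp.fun_pow 2).fun_div ((hy.fun_pow 2).const_sub 1) e1).fun_add
      ((hq.fun_pow 2).fun_div ((hx.fun_pow 2).const_sub 1) e2)
    refine this.congr_deriv ?_
    simp only at e1 e2 ⊢
    field_simp
    ring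
  have := constant_of_has_deriv_right_zero (f := f) (a := 0) (b := τ)
    (fun s hs => (hd s hs).continuousAt.continuousWithinAt)
    (fun s hs => (hd s (Ico_subset_Icc_self hs)).hasDerivWithinAt) t ht
  simpa [hf, h.init] using this

theorem inv_le_inv (h : IsArc z a τ) (ht : t ∈ Icc 0 τ) :
    (1 - (z t).1 ^ 2)⁻¹ ≤ (1 - (z t).2.1 ^ 2)⁻¹ ∧
      (1 - (z t).2.1 ^ 2)⁻¹ ≤ (1 - a ^ 2)⁻¹ ∧ 1 ≤ (1 - (z t).2.1 ^ 2)⁻¹ := by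
  obtain ⟨h1, h2, h3, h4⟩ := h.mem t ht
  have hy := h.y_le ht
  have := h.y_sq_lt ht
  have := h.a_sq_lt
  refine ⟨?_, ?_, ?_⟩
  · gcongr
  · have : 0 ≤ (z t).2.1 := h1.trans h2
    gcongr
  · exact (one_le_inv₀ ‹_›).2 (by nlinarith)

/-- In the region q² ≤ p², and both inverse coefficients are at most 1/(1 - a²), so the energy
identity gives 2p² ≥ 1. -/
theorem p_ge (h : IsArc z a τ) (ht : t ∈ Icc 0 τ) : 7 / 10 ≤ (z t).2.2.1 := by
  obtain ⟨h1, h2, h3, h4⟩ := h.mem t ht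
  obtain ⟨i1, i2, i3⟩ := h.inv_le_inv ht
  have he := h.energy ht
  have hA : 0 < (1 - a ^ 2)⁻¹ := inv_pos.2 h.a_sq_lt
  simp only [div_eq_mul_inv, one_mul] at he
  have hq : (z t).2.2.2 ^ 2 ≤ (z t).2.2.1 ^ 2 := by nlinarith
  have h5 : (1 - a ^ 2)⁻¹ ≤ 2 * (z t).2.2.1 ^ 2 * (1 - a ^ 2)⁻¹ := by
    have e1 : (z t).2.2.1 ^ 2 * (1 - (z t).2.1 ^ 2)⁻¹ ≤ (z t).2.2.1 ^ 2 * (1 - a ^ 2)⁻¹ := by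
      gcongr
    have e2 : (z t).2.2.2 ^ 2 * (1 - (z t).1 ^ 2)⁻¹ ≤ (z t).2.2.1 ^ 2 * (1 - a ^ 2)⁻¹ := by
      refine mul_le_mul hq (i1.trans i2) (inv_nonneg.2 (h.x_sq_lt ht).le) (sq_nonneg _)
    linarith
  have h6 : 1 ≤ 2 * (z t).2.2.1 ^ 2 := by
    by_contra! hlt
    nlinarith
  nlinarith

theorem x_ge (h : IsArc z a τ) (ht : t ∈ Icc 0 τ) : 7 / 10 * t ≤ (z t).1 := by
  have := le_of_hasDerivAt_nonpos ht.1 (f := fun s => 7 / 10 * s - (z s).1)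
    (fun s => ((hasDerivAt_id s).const_mul (7 / 10)).fun_sub (h.curve.hasDerivAt_x s))
    fun s hs => by
      have hs' : s ∈ Icc 0 τ := ⟨hs.1, hs.2.trans ht.2⟩
      rw [(h.phaseBox hs').phaseField_eq]
      have := h.p_ge hs'
      have := (h.inv_le_inv hs').2.2
      simp only
      nlinarith
  simp only [h.init] at this
  linarith

/-- Bounds the time in the region, since 7τ/10 ≤ x ≤ y ≤ a; for a ≤ 15/16 this is less than 2. -/
theorem time_lt (h : IsArc z a τ) (hτ : 0 ≤ τ) : 7 / 10 * τ ≤ a := by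
  have h0 : τ ∈ Icc 0 τ := right_mem_Icc.2 hτ
  linarith [h.x_ge h0, (h.mem τ h0).2.1, h.y_le h0]

theorem gap_lt {s : ℝ} (h : IsArc z a τ) (hs : 0 ≤ s) (hst : s < t) (ht : t ≤ τ) :
    (z t).2.1 - (z t).1 < (z s).2.1 - (z s).1 := by
  refine lt_of_hasDerivAt_neg hst
    (fun r => (h.curve.hasDerivAt_y r).fun_sub (h.curve.hasDerivAt_x r)) fun r hr => ?_
  have hr' : r ∈ Icc 0 τ := ⟨hs.trans hr.1.le, hr.2.le.trans ht⟩
  rw [(h.phaseBox hr').phaseField_eq]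
  have h1 := h.p_ge hr'
  have h2 := (h.inv_le_inv hr').2.2
  have h3 := (h.mem r hr').2.2.1
  have h4 := inv_pos.2 (h.x_sq_lt hr')
  simp only
  nlinarith

theorem turn_lt {s : ℝ} (h : IsArc z a τ) (hs : 0 ≤ s) (hst : s < t) (ht : t ≤ τ) :
    (z t).2.2.1 + (z t).2.2.2 < (z s).2.2.1 + (z s).2.2.2 := by
  refine lt_of_hasDerivAt_neg hst
    (fun r => (h.curve.hasDerivAt_p r).fun_add (h.curve.hasDerivAt_q r)) fun r hr => ?_
  have hr' : r ∈ Icc 0 τ := ⟨hs.trans hr.1.le, hr.2.le.trans ht⟩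
  rw [(h.phaseBox hr').phaseField_eq]
  have h1 := h.p_ge hr'
  have h2 := inv_pos.2 (h.y_sq_lt hr')
  obtain ⟨m1, m2, -, -⟩ := h.mem r hr'
  have h4 : 0 < (z r).2.1 := by linarith [h.x_ge hr', hr.1]
  have h5 : 0 < (z r).2.1 * (z r).2.2.1 ^ 2 * (1 - (z r).2.1 ^ 2)⁻¹ ^ 2 := by positivity
  have h6 : 0 ≤ (z r).1 * (z r).2.2.2 ^ 2 * (1 - (z r).1 ^ 2)⁻¹ ^ 2 := by positivity
  simp only
  linarith

/-- An arc which starts near the centre does not become orthogonal to the diagonal. -/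
theorem turn_pos_of_low (h : IsArc z (1 / 4) τ) (ht : t ∈ Icc 0 τ) :
    0 < (z t).2.2.1 + (z t).2.2.2 := by
  -- As q̇ ≥ -(1/4)(16/15)² > -1/2 and t ≤ 5/14, q stays above -5/28, too small to cancel p ≥ 7/10.
  have := le_of_hasDerivAt_nonpos ht.1 (f := fun s => -(1 / 2 * s) - (z s).2.2.2)
    (fun s => ((hasDerivAt_id s).const_mul (1 / 2)).fun_neg.fun_sub (h.curve.hasDerivAt_q s))
    fun s hs => by
      have hs' : s ∈ Icc 0 τ := ⟨hs.1, hs.2.trans ht.2⟩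
      rw [(h.phaseBox hs').phaseField_eq]
      obtain ⟨m1, m2, -, -⟩ := h.mem s hs'
      have i0 := inv_pos.2 (h.y_sq_lt hs')
      have i1 : (1 - (z s).2.1 ^ 2)⁻¹ ≤ 16 / 15 :=
        (h.inv_le_inv hs').2.1.trans (by norm_num)
      have : (z s).2.1 * (z s).2.2.1 ^ 2 * (1 - (z s).2.1 ^ 2)⁻¹ ^ 2
          ≤ 1 / 4 * 1 * (16 / 15) ^ 2 := by
        have := h.y_le hs'
        have := (h.phaseBox hs').2.2.1
        gcongr
      simp only
      norm_num at this ⊢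
      linarith
  simp only [h.init] at this
  have h1 := h.p_ge ht
  have h2 := h.time_lt (ht.1.trans ht.2)
  linarith [ht.2]

/-- An arc which starts near the edge does not reach the diagonal. -/
theorem gap_pos_of_high (h : IsArc z (15 / 16) τ) (hτ : 0 ≤ τ) :
    (z τ).1 ≠ (z τ).2.1 := by
  intro heq
  have hT : τ ∈ Icc 0 τ := right_mem_Icc.2 hτ
  have low : ∀ s ∈ Icc 0 τ, 4 ≤ (1 - (z s).2.1 ^ 2)⁻¹ ∧ 17 / 20 ≤ (z s).2.1 := by
    intro s hs
    have he := h.energy hs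
    obtain ⟨i1, i2, i3⟩ := h.inv_le_inv hs
    obtain ⟨-, -, hp, hq⟩ := h.phaseBox hs
    obtain ⟨m1, m2, m3, m4⟩ := h.mem s hs
    have hx := inv_pos.2 (h.x_sq_lt hs)
    have hy := h.y_sq_lt hs
    simp only [div_eq_mul_inv, one_mul] at he
    -- The energy is 256/31 > 8, while p², q² ≤ 1 and the y-coefficient is the larger one.
    have key : 4 ≤ (1 - (z s).2.1 ^ 2)⁻¹ := by
      norm_num at he
      nlinarith
    refine ⟨key, ?_⟩
    have : 1 - (z s).2.1 ^ 2 ≤ 4⁻¹ := (le_inv_comm₀ (by norm_num) hy).1 key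
    nlinarith
  -- Since q̇ = -(y p / (1 - y²)) ẋ, q falls at least 9/5 times as fast as x rises. On the diagonal
  -- x ≥ 17/20 would give q < -1 ≤ -p.
  have := le_of_hasDerivAt_nonpos hτ (f := fun s => (z s).2.2.2 + 9 / 5 * (z s).1)
    (fun s => (h.curve.hasDerivAt_q s).fun_add ((h.curve.hasDerivAt_x s).const_mul (9 / 5)))
    fun s hs => by
      rw [(h.phaseBox hs).phaseField_eq]
      obtain ⟨i0, i1⟩ := low s hs
      have hp := h.p_ge hs
      simp only
      have : 9 / 5 ≤ (z s).2.1 * (z s).2.2.1 * (1 - (z s).2.1 ^ 2)⁻¹ := by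
        have : (17 / 20 : ℝ) * (7 / 10) * 4 ≤
            (z s).2.1 * (z s).2.2.1 * (1 - (z s).2.1 ^ 2)⁻¹ := by gcongr
        linarith
      have h0 : 0 ≤ (z s).2.2.1 * (1 - (z s).2.1 ^ 2)⁻¹ := by positivity
      nlinarith [mul_le_mul_of_nonneg_right this h0]
  simp only [h.init] at this
  have h1 := (low τ hT).2
  have h2 := (h.mem τ hT).2.2.2
  have h3 := h.p_le_one hT
  linarith

end IsArc

/-! ### The shooting argument -/

/-- Rescaling makes the range of the quantifier independent of t, so the condition becomes an
intersection of closed ones. -/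
theorem forall_mem_Icc_zero_iff_forall_mul {P : ℝ → Prop} {t : ℝ} (ht : 0 ≤ t) :
    (∀ r ∈ Icc 0 t, P r) ↔ ∀ θ ∈ Icc (0 : ℝ) 1, P (θ * t) := by
  constructor
  · intro h θ hθ
    exact h _ ⟨mul_nonneg hθ.1 ht, mul_le_of_le_one_left ht hθ.2⟩
  · intro h r hr
    rcases ht.eq_or_lt with rfl | h0
    · have : r = 0 := le_antisymm hr.2 hr.1
      simpa [this] using h 0 (by simp)
    · have := h (r / t) ⟨div_nonneg hr.1 ht, div_le_one_of_le₀ hr.2 ht⟩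
      rwa [div_mul_cancel₀ _ h0.ne'] at this

/-- The curve which starts at height `a` leaves `arcRegion`, either through the diagonal or by
turning past the direction orthogonal to the diagonal. -/
theorem IsPhaseCurve.exists_exit {z : ℝ → ℝ × ℝ × ℝ × ℝ} {a : ℝ} (hz : IsPhaseCurve z)
    (init : z 0 = (0, a, 1, 0)) (pos : 0 < a) (le : a ≤ 15 / 16) :
    ∃ τ ∈ Icc (0 : ℝ) 2, IsArc z a τ ∧
      ((z τ).1 = (z τ).2.1 ∨ (z τ).2.2.1 + (z τ).2.2.2 = 0) := by
  by_contra! H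
  have hcont := hz.continuous
  suffices hs : Icc (0 : ℝ) 2 ⊆ {t | ∀ r ∈ Icc 0 t, z r ∈ arcRegion} by
    have h2 : IsArc z a 2 := ⟨hz, init, pos, le, hs (right_mem_Icc.2 zero_le_two)⟩
    linarith [h2.time_lt zero_le_two]
  apply IsClosed.Icc_subset_of_forall_exists_gt
  · have : {t | ∀ r ∈ Icc 0 t, z r ∈ arcRegion} ∩ Icc (0 : ℝ) 2 =
        (⋂ θ ∈ Icc (0 : ℝ) 1, {t | z (θ * t) ∈ arcRegion}) ∩ Icc 0 2 := by
      ext t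
      simp only [mem_inter_iff, mem_iInter, mem_ofPred_eq]
      exact and_congr_left fun ht =>
        forall_mem_Icc_zero_iff_forall_mul (P := fun r => z r ∈ arcRegion) ht.1
    rw [this]
    refine (isClosed_biInter fun θ _ => ?_).inter isClosed_Icc
    exact isClosed_arcRegion.preimage (hcont.comp (continuous_const_mul θ))
  · intro r hr
    have : r = 0 := le_antisymm hr.2 hr.1
    simp [this, init, arcRegion, pos.le]
  · rintro t ⟨ht, ht0, ht2⟩ u hu
    have arc : IsArc z a t := ⟨hz, init, pos, le, ht⟩
    obtain ⟨n1, n2⟩ := H t ⟨ht0, ht2.le⟩ arc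
    obtain ⟨m1, m2, m3, m4⟩ := ht t (right_mem_Icc.2 ht0)
    have g1 : (z t).1 < (z t).2.1 := lt_of_le_of_ne m2 n1
    have g2 : 0 < (z t).2.2.1 + (z t).2.2.2 := lt_of_le_of_ne m4 (Ne.symm n2)
    have e1 : ∀ᶠ r in 𝓝 t, (z r).1 < (z r).2.1 :=
      ContinuousAt.eventually_lt (by fun_prop) (by fun_prop) g1
    have e2 : ∀ᶠ r in 𝓝 t, 0 < (z r).2.2.1 + (z r).2.2.2 :=
      ContinuousAt.eventually_lt (by fun_prop) (by fun_prop) g2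
    have e3 : ∀ᶠ r in 𝓝 t, 0 < (z r).2.1 :=
      ContinuousAt.eventually_lt (by fun_prop) (by fun_prop) (m1.trans_lt g1)
    have e4 : ∀ᶠ r in 𝓝 t, 0 < (z r).2.2.1 :=
      ContinuousAt.eventually_lt (by fun_prop) (by fun_prop) (by linarith)
    obtain ⟨δ, hδ, hball⟩ := Metric.eventually_nhds_iff.1 ((e1.and e2).and (e3.and e4))
    have near : ∀ r, t ≤ r → r ≤ t + δ / 2 → _ := fun r h1 h2 =>
      @hball r (by rw [Real.dist_eq, abs_of_nonneg (by linarith)]; linarith)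
    have hu' : t < u := hu
    refine ⟨min (t + δ / 2) u, fun r hr => ?_, lt_min (by linarith) hu', min_le_right _ _⟩
    rcases le_total r t with hrt | hrt
    · exact ht r ⟨hr.1, hrt⟩
    have hrδ : r ≤ t + δ / 2 := hr.2.trans (min_le_left _ _)
    -- The constraints x ≥ 0 and q ≤ 0 are equalities at time 0, so openness cannot preserve them;
    -- monotonicity of x and q does.
    have hx : -(z r).1 ≤ -(z t).1 :=
      le_of_hasDerivAt_nonpos (f := fun s => -(z s).1) hrt (fun s => (hz.hasDerivAt_x s).fun_neg) fun s hs => by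
        have hp := (near s hs.1 (hs.2.trans hrδ)).2.2
        have := phaseCutoff_nonneg (z s)
        have := warp_pos (z s).2.1
        simp only [phaseField, Prod.smul_fst, smul_eq_mul, neg_nonpos]
        positivity
    have hq : (z r).2.2.2 ≤ (z t).2.2.2 :=
      le_of_hasDerivAt_nonpos (f := fun s => (z s).2.2.2) hrt hz.hasDerivAt_q fun s hs => by
        have hy := (near s hs.1 (hs.2.trans hrδ)).2.1
        have := phaseCutoff_nonneg (z s)
        simp only [phaseField, Prod.smul_snd, smul_eq_mul, mul_neg, neg_nonpos]
        positivity
    obtain ⟨⟨k1, k2⟩, -, -⟩ := near r hrt hrδ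
    exact ⟨by linarith, k1.le, by linarith, k2.le⟩

/-- The initial heights whose arcs reach a closed subset of phase space form a closed set. -/
theorem isClosed_setOf_exists_isArc {z : ℝ → ℝ → ℝ × ℝ × ℝ × ℝ} (hz : ∀ a, IsPhaseCurve (z a))
    (init : ∀ a, z a 0 = (0, a, 1, 0)) {Z : Set (ℝ × ℝ × ℝ × ℝ)} (hZ : IsClosed Z) :
    IsClosed {a | a ∈ Icc (1 / 4 : ℝ) (15 / 16) ∧
      ∃ τ ∈ Icc (0 : ℝ) 2, IsArc (z a) a τ ∧ z a τ ∈ Z} := by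
  obtain ⟨K, hK⟩ := exists_lipschitzWith_phaseField
  have hinit : LipschitzWith 1 fun a => z a 0 := by
    simp only [init]
    refine LipschitzWith.of_dist_le_mul fun a b => ?_
    simp [Prod.dist_eq]
  have hflow := (continuousOn_uncurry_of_hasDerivAt_of_lipschitz hK hz hinit 2).mono
    (prod_mono_left (subset_univ (Icc (1 / 4 : ℝ) (15 / 16))))
  set B : Set (ℝ × ℝ) := Icc (1 / 4 : ℝ) (15 / 16) ×ˢ Icc (0 : ℝ) 2 with hB
  have hBc : IsCompact B := isCompact_Icc.prod isCompact_Icc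
  have hscale : ∀ θ ∈ Icc (0 : ℝ) 1, ContinuousOn (fun w : ℝ × ℝ => z w.1 (θ * w.2)) B := by
    intro θ hθ
    refine hflow.comp (f := fun w : ℝ × ℝ => (w.1, θ * w.2)) (by fun_prop) fun w hw => ?_
    exact ⟨hw.1, mul_nonneg hθ.1 hw.2.1, (mul_le_of_le_one_left hw.2.1 hθ.2).trans hw.2.2⟩
  have hclosed : IsClosed (B ∩ ((⋂ θ ∈ Icc (0 : ℝ) 1, B ∩ {w | z w.1 (θ * w.2) ∈ arcRegion}) ∩
      (B ∩ uncurry z ⁻¹' Z))) := by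
    refine hBc.isClosed.inter ((isClosed_biInter fun θ hθ => ?_).inter ?_)
    · exact (hscale θ hθ).preimage_isClosed_of_isClosed hBc.isClosed isClosed_arcRegion
    · exact hflow.preimage_isClosed_of_isClosed hBc.isClosed hZ
  -- Exit times are confined to [0, 2], so the set is the projection of a compact set.
  convert ((hBc.of_isClosed_subset hclosed inter_subset_left).image continuous_fst).isClosed
    using 1
  ext a
  simp only [mem_ofPred_eq, mem_image, mem_inter_iff, mem_iInter, mem_preimage, Prod.exists,
    exists_and_right, exists_eq_right]
  constructor
  · rintro ⟨ha, τ, hτ, arc, hZτ⟩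
    have hm : (a, τ) ∈ B := ⟨ha, hτ⟩
    exact ⟨τ, hm, fun θ hθ => ⟨hm, (forall_mem_Icc_zero_iff_forall_mul
      (P := fun r => z a r ∈ arcRegion) hτ.1).1 arc.mem θ hθ⟩, hm, hZτ⟩
  · rintro ⟨τ, hm, hR, -, hZτ⟩
    refine ⟨hm.1, τ, hm.2, ⟨hz a, init a, by linarith [hm.1.1], hm.1.2, ?_⟩, hZτ⟩
    exact (forall_mem_Icc_zero_iff_forall_mul (P := fun r => z a r ∈ arcRegion) hm.2.1).2
      fun θ hθ => (hR θ hθ).2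

/-- Some arc meets the diagonal orthogonally. -/
theorem exists_isArc_orthogonal : ∃ (z : ℝ → ℝ × ℝ × ℝ × ℝ) (a T : ℝ), 0 < T ∧ IsArc z a T ∧
    (z T).1 = (z T).2.1 ∧ (z T).2.2.1 + (z T).2.2.2 = 0 := by
  choose z init hz using fun a : ℝ => exists_phaseField_solution (0, a, 1, 0)
  replace hz : ∀ a, IsPhaseCurve (z a) := hz
  have hA := isClosed_setOf_exists_isArc hz init
    (isClosed_eq (f := fun w : ℝ × ℝ × ℝ × ℝ => w.1) (g := fun w => w.2.1)
      (by fun_prop) (by fun_prop))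
  have hB := isClosed_setOf_exists_isArc hz init
    (isClosed_eq (f := fun w : ℝ × ℝ × ℝ × ℝ => w.2.2.1 + w.2.2.2) (g := fun _ => 0)
      (by fun_prop) (by fun_prop))
  have l : (1 / 4 : ℝ) ∈ Icc (1 / 4 : ℝ) (15 / 16) := by norm_num
  have r : (15 / 16 : ℝ) ∈ Icc (1 / 4 : ℝ) (15 / 16) := by norm_num
  obtain ⟨a, ha, ⟨-, τ, hτ, arc, hτd⟩, -, σ, hσ, arc', hσo⟩ :=
    isPreconnected_closed_iff.1 (isPreconnected_Icc (a := (1 / 4 : ℝ)) (b := 15 / 16)) _ _ hA hB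
      (fun a ha => by
        obtain ⟨τ, hτ, arc, h | h⟩ :=
          (hz a).exists_exit (init a) (by linarith [ha.1]) ha.2
        · exact Or.inl ⟨ha, τ, hτ, arc, h⟩
        · exact Or.inr ⟨ha, τ, hτ, arc, h⟩)
      (by
        obtain ⟨τ, hτ, arc, h | h⟩ := (hz _).exists_exit (init (1 / 4)) (by norm_num) (by norm_num)
        · exact ⟨_, l, l, τ, hτ, arc, h⟩
        · exact absurd h (arc.turn_pos_of_low (right_mem_Icc.2 hτ.1)).ne')
      (by
        obtain ⟨τ, hτ, arc, h | h⟩ := (hz _).exists_exit (init (15 / 16)) (by norm_num) le_rfl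
        · exact absurd h (arc.gap_pos_of_high hτ.1)
        · exact ⟨_, r, r, τ, hτ, arc, h⟩)
  simp only [mem_ofPred_eq] at hτd hσo
  have hτσ : τ = σ := by
    -- After the earlier event, y - x or p + q would become negative while the longer arc is still
    -- in the region.
    rcases lt_trichotomy τ σ with h | h | h
    · linarith [arc'.gap_lt hτ.1 h le_rfl, (arc'.mem σ (right_mem_Icc.2 hσ.1)).2.1]
    · exact h
    · linarith [arc.turn_lt hσ.1 h le_rfl, (arc.mem τ (right_mem_Icc.2 hτ.1)).2.2.2]
  subst hτσ
  refine ⟨z a, a, τ, hτ.1.lt_of_ne ?_, arc, hτd, hσo⟩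
  rintro rfl
  rw [init] at hτd
  exact arc.pos.ne hτd

/-! ### Reflection symmetries -/

theorem forall_of_periodic {Q : ℝ → Prop} {T : ℝ} (hT : 0 < T)
    (hper : ∀ t, Q (t + 2 * T) ↔ Q t) (h : ∀ t ∈ Ico (-T) T, Q t) (t : ℝ) : Q t := by
  have hQ : Periodic Q (2 * T) := fun t => propext (hper t)
  obtain ⟨s, hs, hst⟩ := hQ.exists_mem_Ico (by linarith) t (-T)
  rw [hst]
  exact h s ⟨hs.1, by linarith [hs.2]⟩

namespace IsPhaseCurve

variable {z : ℝ → ℝ × ℝ × ℝ × ℝ}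

theorem eq_of_eq {w : ℝ → ℝ × ℝ × ℝ × ℝ} (hz : IsPhaseCurve z) (hw : IsPhaseCurve w) (t₀ : ℝ)
    (h : z t₀ = w t₀) : z = w := by
  obtain ⟨K, hK⟩ := exists_lipschitzWith_phaseField
  exact eq_of_hasDerivAt_of_lipschitz hK hz hw t₀ h

/-- A curve which starts horizontally from the `y`-axis is symmetric in the `y`-axis. -/
theorem apply_neg (hz : IsPhaseCurve z) (hx : (z 0).1 = 0) (hq : (z 0).2.2.2 = 0) (t : ℝ) :
    z (-t) = (-(z t).1, (z t).2.1, (z t).2.2.1, -(z t).2.2.2) := by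
  -- Time reversal and the reflection both flip the sign of p, so p is kept and q is negated.
  have hw : IsPhaseCurve fun t =>
      (-(z (-t)).1, (z (-t)).2.1, (z (-t)).2.2.1, -(z (-t)).2.2.2) := by
    intro t
    have h : HasDerivAt (fun t => z (-t)) ((-1 : ℝ) • phaseField (z (-t))) t :=
      (hz (-t)).scomp t (hasDerivAt_neg t)
    have h1 : HasDerivAt (fun t => (z (-t)).1) (-1 * (phaseField (z (-t))).1) t := h.fst
    have h2 : HasDerivAt (fun t => (z (-t)).2.1) (-1 * (phaseField (z (-t))).2.1) t := h.snd.fst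
    have h3 : HasDerivAt (fun t => (z (-t)).2.2.1) (-1 * (phaseField (z (-t))).2.2.1) t :=
      h.snd.snd.fst
    have h4 : HasDerivAt (fun t => (z (-t)).2.2.2) (-1 * (phaseField (z (-t))).2.2.2) t :=
      h.snd.snd.snd
    refine (h1.fun_neg.prodMk (h2.prodMk (h3.prodMk h4.fun_neg))).congr_deriv ?_
    simp [phaseField, phaseCutoff, warp_neg]
  have := congrFun (hz.eq_of_eq hw 0 (by simp [Prod.ext_iff, hx, hq])) (-t)
  simpa using this

/-- A curve which meets the diagonal orthogonally is symmetric in the diagonal. -/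
theorem apply_two_mul_sub {T : ℝ} (hz : IsPhaseCurve z) (hT : (z T).1 = (z T).2.1)
    (ho : (z T).2.2.1 + (z T).2.2.2 = 0) (t : ℝ) :
    z (2 * T - t) = ((z t).2.1, (z t).1, -(z t).2.2.2, -(z t).2.2.1) := by
  have hw : IsPhaseCurve fun t => ((z (2 * T - t)).2.1, (z (2 * T - t)).1,
      -(z (2 * T - t)).2.2.2, -(z (2 * T - t)).2.2.1) := by
    intro t
    have h : HasDerivAt (fun t => z (2 * T - t)) ((-1 : ℝ) • phaseField (z (2 * T - t))) t :=
      (hz (2 * T - t)).scomp t ((hasDerivAt_id t).const_sub (2 * T))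
    have h1 : HasDerivAt (fun t => (z (2 * T - t)).1) (-1 * (phaseField (z (2 * T - t))).1) t := h.fst
    have h2 : HasDerivAt (fun t => (z (2 * T - t)).2.1) (-1 * (phaseField (z (2 * T - t))).2.1) t := h.snd.fst
    have h3 : HasDerivAt (fun t => (z (2 * T - t)).2.2.1) (-1 * (phaseField (z (2 * T - t))).2.2.1) t :=
      h.snd.snd.fst
    have h4 : HasDerivAt (fun t => (z (2 * T - t)).2.2.2) (-1 * (phaseField (z (2 * T - t))).2.2.2) t :=
      h.snd.snd.snd
    refine (h2.prodMk (h1.prodMk (h4.fun_neg.prodMk h3.fun_neg))).congr_deriv ?_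
    have : ∀ a b c d : ℝ, a + b + c + d = b + a + d + c := fun a b c d => by ring
    simp [phaseField, phaseCutoff, this ((z (2 * T - t)).2.1 ^ 2)]
  have := congrFun (hz.eq_of_eq hw T (by
    have e : 2 * T - T = T := by ring
    simp only [e, Prod.ext_iff]
    exact ⟨hT, hT.symm, by linarith, by linarith⟩)) (2 * T - t)
  simpa using this

/-- The velocity of the projection of a phase curve to the square. -/
theorem deriv_proj (hz : IsPhaseCurve z) (hbox : ∀ t, PhaseBox (z t)) :
    deriv (fun t => ![(z t).1, (z t).2.1]) =
      fun t => ![(z t).2.2.1 * (1 - (z t).2.1 ^ 2)⁻¹, (z t).2.2.2 * (1 - (z t).1 ^ 2)⁻¹] := by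
  funext t
  refine HasDerivAt.deriv (hasDerivAt_pi.2 fun i => ?_)
  have h1 := hz.hasDerivAt_x t
  have h2 := hz.hasDerivAt_y t
  rw [(hbox t).phaseField_eq] at h1 h2
  fin_cases i
  · exact h1
  · exact h2

end IsPhaseCurve

/-! ### The geodesic equation -/

theorem squareMetric_partialDeriv (k i j : Fin 2) (v : Fin 2 → ℝ) :
    squareMetric.partialDeriv k i j v =
      if i = j then if k = i then 0 else -2 * v k else 0 := by
  have h0 : HasFDerivAt (fun q : Fin 2 → ℝ => 1 - q 1 ^ 2)
      (-((2 * v 1) • ContinuousLinearMap.proj (R := ℝ) (φ := fun _ : Fin 2 => ℝ) 1)) v := by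
    have := (HasFDerivAt.pow (hasFDerivAt_apply (𝕜 := ℝ) (1 : Fin 2) v) 2).const_sub 1
    refine this.congr_fderiv ?_
    ext; simp
  have h1 : HasFDerivAt (fun q : Fin 2 → ℝ => 1 - q 0 ^ 2)
      (-((2 * v 0) • ContinuousLinearMap.proj (R := ℝ) (φ := fun _ : Fin 2 => ℝ) 0)) v := by
    have := (HasFDerivAt.pow (hasFDerivAt_apply (𝕜 := ℝ) (0 : Fin 2) v) 2).const_sub 1
    refine this.congr_fderiv ?_
    ext; simp
  fin_cases i <;> fin_cases j <;> fin_cases k <;>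
    simp [CoordMetric.partialDeriv, squareMetric, h0.fderiv, h1.fderiv]

theorem squareMetric_inv {v : Fin 2 → ℝ} (h0 : 1 - v 1 ^ 2 ≠ 0) (h1 : 1 - v 0 ^ 2 ≠ 0) :
    (squareMetric.mat v)⁻¹ = Matrix.diagonal ![(1 - v 1 ^ 2)⁻¹, (1 - v 0 ^ 2)⁻¹] := by
  refine Matrix.inv_eq_right_inv ?_
  simp only [squareMetric, Matrix.diagonal_mul_diagonal]
  rw [← Matrix.diagonal_one]
  congr 1
  ext i
  fin_cases i
  · simpa using mul_inv_cancel₀ h0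
  · simpa using mul_inv_cancel₀ h1

/-- The phase curves in the box project to geodesics. -/
theorem IsPhaseCurve.isGeodesic {z : ℝ → ℝ × ℝ × ℝ × ℝ} (hz : IsPhaseCurve z)
    (hbox : ∀ t, PhaseBox (z t)) :
    squareMetric.IsGeodesic fun t => ![(z t).1, (z t).2.1] where
  mem t := by
    obtain ⟨h1, h2, -, -⟩ := hbox t
    constructor
    · simpa using (sq_lt_one_iff_abs_lt_one _).1 (h1.trans_lt (by norm_num))
    · simpa using (sq_lt_one_iff_abs_lt_one _).1 (h2.trans_lt (by norm_num))
  smooth := by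
    have h := contDiff_of_hasDerivAt_of_contDiff contDiff_phaseField hz
    rw [contDiff_pi]
    intro i
    fin_cases i
    · exact h.fst
    · exact h.snd.fst
  eqn t k := by
    have hx := hz.hasDerivAt_x t
    have hy := hz.hasDerivAt_y t
    have hp := hz.hasDerivAt_p t
    have hq := hz.hasDerivAt_q t
    rw [(hbox t).phaseField_eq] at hx hy hp hq
    have ey : 1 - (z t).2.1 ^ 2 ≠ 0 := by linarith [(hbox t).2.1]
    have ex : 1 - (z t).1 ^ 2 ≠ 0 := by linarith [(hbox t).1]
    have du := hp.fun_mul (((hy.fun_pow 2).const_sub 1).fun_inv ey)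
    have dv := hq.fun_mul (((hx.fun_pow 2).const_sub 1).fun_inv ex)
    have dd := (hasDerivAt_pi (φ := fun t => ![(z t).2.2.1 * (1 - (z t).2.1 ^ 2)⁻¹,
      (z t).2.2.2 * (1 - (z t).1 ^ 2)⁻¹]) (φ' := ![_, _]).2 fun i => by
        fin_cases i
        · exact du
        · exact dv).deriv
    rw [hz.deriv_proj hbox, dd]
    simp only [CoordMetric.christoffel, squareMetric_partialDeriv,
      squareMetric_inv (v := ![(z t).1, (z t).2.1]) ey ex]
    fin_cases k
    · simp [Fin.sum_univ_two]
      field_simp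
      ring
    · simp [Fin.sum_univ_two]
      field_simp
      ring

/-! ### Closing up the arc -/

theorem mainTheorem8 :
    ∃ (γ : ℝ → Fin 2 → ℝ) (T : ℝ), 0 < T ∧
      -- `γ` is an embedded closed geodesic of period `8 T`
      squareMetric.IsEmbeddedClosedGeodesic γ (8 * T) ∧
      -- it leaves the positive `y`-axis horizontally
      γ 0 0 = 0 ∧ 0 < γ 0 1 ∧ 0 < deriv γ 0 0 ∧ deriv γ 0 1 = 0 ∧
      -- it stays between the `y`-axis and the diagonal `x = y` up to the time `T`
      (∀ t ∈ Set.Ioo 0 T, 0 < γ t 0 ∧ γ t 0 < γ t 1) ∧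
      -- at the time `T` it meets the diagonal orthogonally, away from the origin
      γ T 0 = γ T 1 ∧ 0 < γ T 0 ∧ squareMetric.inner (γ T) (deriv γ T) ![1, 1] = 0 ∧
      -- it is obtained from this arc by reflection in the `y`-axis and in the diagonal
      (∀ t, γ (-t) = ![-γ t 0, γ t 1]) ∧
      (∀ t, γ (2 * T - t) = ![γ t 1, γ t 0]) := by
  obtain ⟨z, a, T, hT, arc, hd, ho⟩ := exists_isArc_orthogonal
  have hz := arc.curve
  have hneg := hz.apply_neg (by simp [arc.init]) (by simp [arc.init])
  have hrefl := hz.apply_two_mul_sub hd ho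
  -- The composition of the two reflections is a clockwise quarter turn.
  have hrot : ∀ t, z (t + 2 * T) = ((z t).2.1, -(z t).1, (z t).2.2.2, -(z t).2.2.1) := by
    intro t
    have := hrefl (-t)
    rw [hneg t] at this
    rw [show t + 2 * T = 2 * T - -t by ring, this]
    simp
  have hp : ∀ t ∈ Icc (-T) T, PhaseBox (z t) ∧ 7 / 10 ≤ (z t).2.2.1 := by
    have pos : ∀ t ∈ Icc 0 T, PhaseBox (z t) ∧ 7 / 10 ≤ (z t).2.2.1 :=
      fun t ht => ⟨arc.phaseBox ht, arc.p_ge ht⟩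
    intro t ht
    rcases le_total 0 t with h | h
    · exact pos t ⟨h, ht.2⟩
    · have := pos (-t) ⟨by linarith, by linarith [ht.1]⟩
      rw [hneg t] at this
      simpa [PhaseBox] using this
  have hbox' : ∀ t, PhaseBox (z t) ∧ ((z t).2.2.1 ≠ 0 ∨ (z t).2.2.2 ≠ 0) := by
    refine forall_of_periodic hT (fun t => ?_) fun t ht => ?_
    · rw [hrot t]
      simp only [PhaseBox, neg_sq, ne_eq, neg_eq_zero]
      tauto
    · obtain ⟨h1, h2⟩ := hp t (Ico_subset_Icc_self ht)
      exact ⟨h1, Or.inl (by linarith)⟩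
  have hbox : ∀ t, PhaseBox (z t) := fun t => (hbox' t).1
  have hy : ∀ t, 0 < (1 - (z t).2.1 ^ 2)⁻¹ := fun t => inv_pos.2 (by linarith [(hbox t).2.1])
  have hx : ∀ t, 0 < (1 - (z t).1 ^ 2)⁻¹ := fun t => inv_pos.2 (by linarith [(hbox t).1])
  have hderiv := hz.deriv_proj hbox
  have hgap : ∀ t, 0 ≤ t → t < T → (z t).1 < (z t).2.1 := fun t h0 h1 => by
    linarith [arc.gap_lt h0 h1 le_rfl]
  have hxpos : ∀ t, 0 < t → t ≤ T → 0 < (z t).1 := fun t h0 h1 => by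
    linarith [arc.x_ge ⟨h0.le, h1⟩]
  -- The cone is half-open like the time interval, so that its four rotations are disjoint.
  have hcone : ∀ t ∈ Ico (-T) T, -(z t).2.1 ≤ (z t).1 ∧ (z t).1 < (z t).2.1 := by
    intro t ht
    rcases le_or_gt 0 t with h | h
    · obtain ⟨m1, m2, -⟩ := arc.mem t ⟨h, ht.2.le⟩
      exact ⟨by linarith, hgap t h ht.2⟩
    · have h1 : -t ≤ T := by linarith [ht.1]
      have h2 := hxpos (-t) (by linarith) h1
      obtain ⟨m1, m2, -⟩ := arc.mem (-t) ⟨by linarith, h1⟩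
      rw [hneg t] at h2 m1 m2
      simp only at h2 m1 m2
      exact ⟨by linarith, by linarith⟩
  have hmono : ∀ s t, -T ≤ s → s < t → t ≤ T → (z s).1 < (z t).1 := by
    intro s t hs hst ht
    have := lt_of_hasDerivAt_neg (f := fun s => -(z s).1) hst
      (fun s => (hz.hasDerivAt_x s).fun_neg) fun r hr => by
        rw [(hbox r).phaseField_eq]
        have h1 := (hp r ⟨hs.trans hr.1.le, hr.2.le.trans ht⟩).2
        have h2 := hy r
        simp only [neg_lt_zero]
        positivity
    linarith
  have hrot2 : ∀ t, z (t + 4 * T) = (-(z t).1, -(z t).2.1, -(z t).2.2.1, -(z t).2.2.2) := by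
    intro t
    rw [show t + 4 * T = t + 2 * T + 2 * T by ring, hrot, hrot]
  have hper : ∀ t, z (t + 8 * T) = z t := by
    intro t
    rw [show t + 8 * T = t + 4 * T + 4 * T by ring, hrot2, hrot2]
    simp
  -- The statement is invariant under the quarter turn, so s may be taken in [-T, T). Then s + d
  -- lies in the same piece, in one of three rotated pieces in disjoint cones, or in the first piece
  -- of the next period, before s.
  have hinj : ∀ s, ∀ d ∈ Ico 0 (8 * T), (z s).1 = (z (s + d)).1 →
      (z s).2.1 = (z (s + d)).2.1 → d = 0 := by
    refine forall_of_periodic hT (fun s => ?_) fun s hs d hd ex ey => ?_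
    · refine forall₂_congr fun d _ => ?_
      rw [show s + 2 * T + d = s + d + 2 * T by ring, hrot, hrot]
      simp only [neg_inj]
      exact forall_comm
    obtain ⟨c1, c2⟩ := hcone s hs
    rcases lt_or_ge (s + d) T with h1 | h1
    · rcases hd.1.eq_or_lt with h | h
      · exact h.symm
      · linarith [hmono s (s + d) hs.1 (by linarith) h1.le]
    rcases lt_or_ge (s + d) (3 * T) with h2 | h2
    · obtain ⟨e1, e2⟩ := hcone (s + d - 2 * T) ⟨by linarith, by linarith⟩
      have := hrot (s + d - 2 * T)
      rw [sub_add_cancel] at this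
      rw [this] at ex ey
      simp only at ex ey
      linarith
    rcases lt_or_ge (s + d) (5 * T) with h3 | h3
    · obtain ⟨e1, e2⟩ := hcone (s + d - 4 * T) ⟨by linarith, by linarith⟩
      have := hrot2 (s + d - 4 * T)
      rw [sub_add_cancel] at this
      rw [this] at ex ey
      simp only at ex ey
      linarith
    rcases lt_or_ge (s + d) (7 * T) with h4 | h4
    · obtain ⟨e1, e2⟩ := hcone (s + d - 6 * T) ⟨by linarith, by linarith⟩
      have := hrot2 (s + d - 6 * T + 2 * T)
      rw [show s + d - 6 * T + 2 * T + 4 * T = s + d by ring, hrot] at this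
      rw [this] at ex ey
      simp only at ex ey
      linarith
    · have := hper (s + d - 8 * T)
      rw [sub_add_cancel] at this
      rw [this] at ex
      linarith [hmono (s + d - 8 * T) s (by linarith) (by linarith [hd.2]) hs.2.le]
  refine ⟨fun t => ![(z t).1, (z t).2.1], T, hT, ⟨hz.isGeodesic hbox, by linarith, ?_, ?_, ?_⟩,
    ?_, ?_, ?_, ?_, ?_, hd, hxpos T hT le_rfl, ?_, ?_, ?_⟩
  · intro t
    simp only [hper]
  · intro t h
    rw [hderiv] at h
    have e0 := congrFun h 0
    have e1 := congrFun h 1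
    simp only [Matrix.cons_val_zero, Matrix.cons_val_one, Pi.zero_apply, mul_eq_zero,
      (hy t).ne', (hx t).ne', or_false] at e0 e1
    exact (hbox' t).2.elim (fun h => h e0) fun h => h e1
  · have key : ∀ s ∈ Ico 0 (8 * T), ∀ t ∈ Ico 0 (8 * T), s ≤ t →
        ![(z s).1, (z s).2.1] = ![(z t).1, (z t).2.1] → s = t := by
      intro s hs t ht hst h
      have e0 : (z s).1 = (z t).1 := congrFun h 0
      have e1 : (z s).2.1 = (z t).2.1 := congrFun h 1
      have := hinj s (t - s) ⟨by linarith, by linarith [hs.1, ht.2]⟩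
        (by simpa using e0) (by simpa using e1)
      linarith
    intro s hs t ht h
    rcases le_total s t with hst | hst
    · exact key s hs t ht hst h
    · exact (key t ht s hs hst h.symm).symm
  · simp [arc.init]
  · simpa [arc.init] using arc.pos
  · rw [hderiv]
    have := hy 0
    simp only [arc.init] at this
    simpa [arc.init] using this
  · rw [hderiv]
    simp [arc.init]
  · intro t ht
    exact ⟨hxpos t ht.1 ht.2.le, hgap t ht.1.le ht.2⟩
  · rw [hderiv]
    have e1 := (inv_pos.1 (hy T)).ne'
    have e2 := (inv_pos.1 (hx T)).ne'
    simp only [CoordMetric.inner, squareMetric, Fin.sum_univ_two]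
    simp
    field_simp
    exact ho
  · intro t
    simp [hneg t]
  · intro t
    simp [hrefl t]
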